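/- Let $A$ and $B$ be unital semisimple complex Banach algebras, where semisimple means that the Jacobson radical is zero. A linear mapping $S\colon C\to D$ between unital complex algebras is called a spectral isometry if $r(Sc)=r(c)$ for every $c\in C$, where $r$ denotes the spectral radius; it is called unital if $S1=1$, multiplicative if $S(xy)=S(x)S(y)$ for all $x,y\in C$, and anti-multiplicative if $S(xy)=S(y)S(x)$ for all $x,y\in C$. Let $T\colon A\to B$ be a unital surjective spectral isometry. Suppose that there is a family $\mathcal I$ of closed two-sided ideals of $B$ which is separating, that is, $\bigcap_{I\in\mathcal I} I=\{0\}$, such that, for every $I\in\mathcal I$, the quotient algebra $B/I$ is semisimple and each unital surjective spectral isometry $S\colon B/I\to B/I$ is multiplicative or anti-multiplicative. Then $T$ preserves invertibility, that is, $Ta$ is invertible in $B$ whenever $a$ is invertible in $A$. If, moreover, $A$ is a C*-algebra, then $T$ is a Jordan isomorphism, that is, $T$ is bijective and $T(ab+ba)=(Ta)(Tb)+(Tb)(Ta)$ for all $a,b\in A$. -/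

import Mathlib

/-- A ring is semisimple, in the sense of Banach algebra theory, if its Jacobson radical is zero.
(This is not Mathlib's `IsSemisimpleRing`, which also forces the ring to be Artinian.) -/
def IsJacobsonSemisimple (R : Type*) [Ring R] : Prop :=
  Ring.jacobson R = ⊥

section

variable {A B : Type*} [Ring A] [Algebra ℂ A] [Ring B] [Algebra ℂ B]

/-- A spectral isometry is a linear map which preserves the spectral radius of every element. -/
def IsSpectralIsometry (T : A →ₗ[ℂ] B) : Prop :=
  ∀ a : A, spectralRadius ℂ (T a) = spectralRadius ℂ a

/-- A unital surjective spectral isometry. -/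
structure IsUnitalSurjectiveSpectralIsometry (T : A →ₗ[ℂ] B) : Prop where
  map_one : T 1 = 1
  surjective : Function.Surjective T
  isSpectralIsometry : IsSpectralIsometry T

/-- A linear map is multiplicative if it preserves products. -/
def IsMultiplicative (T : A →ₗ[ℂ] B) : Prop :=
  ∀ x y : A, T (x * y) = T x * T y

/-- A linear map is anti-multiplicative if it reverses products. -/
def IsAntiMultiplicative (T : A →ₗ[ℂ] B) : Prop :=
  ∀ x y : A, T (x * y) = T y * T x

/-- A linear map preserves invertibility if it sends invertible elements to invertible elements. -/
def PreservesInvertibility (T : A →ₗ[ℂ] B) : Prop :=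
  ∀ a : A, IsUnit a → IsUnit (T a)

/-- A Jordan isomorphism is a bijective linear map `T` with
`T (a b + b a) = (T a) (T b) + (T b) (T a)` for all `a` and `b`. -/
structure IsJordanIsomorphism (T : A →ₗ[ℂ] B) : Prop where
  bijective : Function.Bijective T
  map_jordan : ∀ a b : A, T (a * b + b * a) = T a * T b + T b * T a

end

/-!
Let `r` be the spectral radius and `T : A → B` a unital surjective spectral isometry of semisimple
Banach algebras.

*Tools.* The maximum principle, applied to large powers, gives a three circles theorem for `r` of
an analytic function (`specRad_sq_le_of_circles`), and hence a Liouville theorem: if `f` is entire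
and `r (f z)` is bounded then `r (f z)` is constant (`specRad_eq_of_differentiable_of_bounded`).
Schur's lemma and the density theorem for two vectors show that `b` lies in the radical as soon as
`r (b + z) ≤ r z` for all `z` (`mem_jacobson_of_specRad_add_le`). Together these make `T` injective
and continuous.

*Automorphisms of `B`.* For `x` in `A` let `Φₓ b = T (eˣ (T⁻¹ b) e⁻ˣ)`. If `π : B → B ⧸ I` is the
quotient map for an ideal of the family, then `r (π (Φ_{cx} b)) ≤ r b` for every complex `c`, so by
Liouville `r (π (Φₓ b)) = r (π b)`. As `B ⧸ I` is semisimple, it follows that `Φₓ` leaves `I`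
invariant and induces a unital surjective spectral isometry of `B ⧸ I`. That map is the square of
the one induced by `Φ_{x/2}`, which is multiplicative or anti-multiplicative, and so it is
multiplicative. Since the family is separating, `Φₓ` is an automorphism of `B`
(`transportConj_mul`).

*Reduction to the commutative case.* Consequently, if `y` commutes with `T⁻¹ b` and `T⁻¹ c`, then it
commutes with `T⁻¹ (b c)`. So for the double commutant `C` of an element `x` of `A`, which is a
commutative Banach algebra, `T C` is a closed subalgebra of `B`. There `r` is subadditive, which
makes `T C` commutative modulo its radical (`commutator_mem_jacobson_of_specRad_add_le`), and a form
of Nagasawa's theorem (`specRad_map_mul_sub_eq_zero`) shows that `T` is multiplicative on `C` modulo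
quasinilpotents. If `x` is invertible, its inverse lies in `C`, no character of `T C` vanishes at
`T x`, and `T x` is invertible. If `A` is a C⋆-algebra and `x` is self-adjoint, then `C` consists of
normal elements, `r` is the norm on `C`, and therefore `T (x²) = (T x)²`; polarization gives the
Jordan identity.
-/

open Filter Topology

/-! ### The spectral radius: Gelfand's formula, three circles, Liouville -/

section SpecRad
variable {B : Type*} [NormedRing B] [NormedAlgebra ℂ B]

/-- The spectral radius as a real number. -/
noncomputable def specRad (b : B) : ℝ := (spectralRadius ℂ b).toReal

lemma specRad_nonneg (b : B) : 0 ≤ specRad b := ENNReal.toReal_nonneg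

lemma specRad_units_conj (u : Bˣ) (b : B) : specRad (u * b * ↑u⁻¹) = specRad b := by
  simp [specRad, spectralRadius]

variable [CompleteSpace B]

lemma spectralRadius_le_ofReal_norm (b : B) : spectralRadius ℂ b ≤ ENNReal.ofReal ‖b‖ := by
  refine le_of_tendsto (spectrum.pow_norm_pow_one_div_tendsto_nhds_spectralRadius b) ?_
  filter_upwards [eventually_gt_atTop 0] with n hn
  refine ENNReal.ofReal_le_ofReal ?_
  calc (‖b ^ n‖) ^ (1 / n : ℝ) ≤ (‖b‖ ^ n) ^ (1 / n : ℝ) :=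
        Real.rpow_le_rpow (norm_nonneg _) (norm_pow_le' b hn) (by positivity)
    _ = ‖b‖ := by
        rw [one_div, Real.pow_rpow_inv_natCast (norm_nonneg _) hn.ne']

lemma spectralRadius_ne_top (b : B) : spectralRadius ℂ b ≠ ⊤ :=
  ((spectralRadius_le_ofReal_norm b).trans_lt ENNReal.ofReal_lt_top).ne

lemma specRad_le_norm (b : B) : specRad b ≤ ‖b‖ :=
  ENNReal.toReal_le_of_le_ofReal (norm_nonneg _) (spectralRadius_le_ofReal_norm b)

lemma tendsto_specRad (b : B) :
    Tendsto (fun n : ℕ => ‖b ^ n‖ ^ (1 / n : ℝ)) atTop (𝓝 (specRad b)) := by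
  have h := (ENNReal.tendsto_toReal (spectralRadius_ne_top b)).comp
    (spectrum.pow_norm_pow_one_div_tendsto_nhds_spectralRadius b)
  refine h.congr fun n => ?_
  simp only [Function.comp_apply]
  rw [ENNReal.toReal_ofReal (by positivity)]

lemma norm_le_specRad_of_mem {b : B} {c : ℂ} (hc : c ∈ spectrum ℂ b) : ‖c‖ ≤ specRad b := by
  have h : (‖c‖₊ : ENNReal) ≤ spectralRadius ℂ b :=
    le_iSup₂ (f := fun k (_ : k ∈ spectrum ℂ b) => (‖k‖₊ : ENNReal)) c hc
  have := ENNReal.toReal_mono (spectralRadius_ne_top b) h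
  simpa [specRad] using this

lemma exists_mem_spectrum_norm_eq [Nontrivial B] (b : B) :
    ∃ c ∈ spectrum ℂ b, ‖c‖ = specRad b := by
  obtain ⟨c, hc, h⟩ := spectrum.exists_nnnorm_eq_spectralRadius b
  exact ⟨c, hc, by simp [specRad, ← h]⟩

lemma specRad_pow_le_norm_pow (b : B) {n : ℕ} (hn : n ≠ 0) : specRad b ^ n ≤ ‖b ^ n‖ := by
  refine le_trans ?_ (specRad_le_norm (b ^ n))
  have := ENNReal.toReal_mono (spectralRadius_ne_top (b ^ n))
    (spectrum.spectralRadius_pow_le (𝕜 := ℂ) b n hn)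
  simpa [specRad] using this

lemma eventually_norm_pow_lt {b : B} {M : ℝ} (h : specRad b < M) :
    ∀ᶠ n : ℕ in atTop, ‖b ^ n‖ < M ^ n := by
  filter_upwards [(tendsto_specRad b).eventually_lt_const h, eventually_gt_atTop 0] with n hn h0
  have := pow_lt_pow_left₀ hn (by positivity) h0.ne'
  rwa [one_div, Real.rpow_inv_natCast_pow (norm_nonneg _) h0.ne'] at this

/-- The spectral radius is upper semicontinuous. -/
lemma eventually_specRad_lt {b : B} {M : ℝ} (h : specRad b < M) :
    ∀ᶠ x in 𝓝 b, specRad x < M := by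
  obtain ⟨M', h1, h2⟩ := exists_between h
  obtain ⟨n, hn, h0⟩ := ((eventually_norm_pow_lt h1).and (eventually_gt_atTop 0)).exists
  have hc : ContinuousAt (fun x : B => ‖x ^ n‖) b := by fun_prop
  filter_upwards [hc.eventually_lt_const hn] with x hx
  refine lt_of_le_of_lt ?_ h2
  have := (specRad_pow_le_norm_pow x h0.ne').trans hx.le
  exact le_of_pow_le_pow_left₀ h0.ne' ((specRad_nonneg b).trans h1.le) this

lemma specRad_smul (c : ℂ) (b : B) : specRad (c • b) = ‖c‖ * specRad b := by
  refine tendsto_nhds_unique (tendsto_specRad (c • b)) ?_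
  refine ((tendsto_specRad b).const_mul ‖c‖).congr' ?_
  filter_upwards [eventually_gt_atTop 0] with n hn
  rw [smul_pow, norm_smul, norm_pow c, Real.mul_rpow (by positivity) (by positivity), one_div,
    Real.pow_rpow_inv_natCast (norm_nonneg _) hn.ne']

lemma specRad_neg (b : B) : specRad (-b) = specRad b := by
  simpa using specRad_smul (-1) b

/-- The spectral radius is determined by the norm, so it is the same in a closed subalgebra. -/
lemma specRad_subalgebra (S : Subalgebra ℂ B) [CompleteSpace S] (b : S) :
    specRad b = specRad (b : B) :=
  tendsto_nhds_unique (tendsto_specRad b) (tendsto_specRad (b : B))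

/-- If the spectral radius of `f z` is less than `M` for all `z` in a compact set, then a single
power (which can be taken to be any large power of two) witnesses this for all `z`. -/
lemma exists_forall_norm_pow_lt {K : Set ℂ} (hK : IsCompact K) {f : ℂ → B}
    (hf : ContinuousOn f K) {M : ℝ} (h : ∀ z ∈ K, specRad (f z) < M) :
    ∃ k₀ : ℕ, ∀ k ≥ k₀, ∀ z ∈ K, ‖f z ^ 2 ^ k‖ < M ^ 2 ^ k := by
  refine hK.induction_on (p := fun s => ∃ k₀ : ℕ, ∀ k ≥ k₀, ∀ z ∈ s, ‖f z ^ 2 ^ k‖ < M ^ 2 ^ k)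
    ?_ ?_ ?_ ?_
  · exact ⟨0, by simp⟩
  · rintro s t hst ⟨k₀, h₀⟩
    exact ⟨k₀, fun k hk z hz => h₀ k hk z (hst hz)⟩
  · rintro s t ⟨k₀, h₀⟩ ⟨k₁, h₁⟩
    refine ⟨max k₀ k₁, fun k hk z hz => ?_⟩
    rcases hz with hz | hz
    · exact h₀ k (le_of_max_le_left hk) z hz
    · exact h₁ k (le_of_max_le_right hk) z hz
  · intro z hz
    obtain ⟨k₀, hk₀⟩ := ((tendsto_pow_atTop_atTop_of_one_lt
      (one_lt_two (α := ℕ))).eventually (eventually_norm_pow_lt (h z hz))).exists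
    have hc : ContinuousWithinAt (fun w => ‖f w ^ 2 ^ k₀‖) K z := ((hf z hz).pow _).norm
    refine ⟨_, hc.eventually_lt_const hk₀, k₀, fun k hk w hw => ?_⟩
    have hw' : ‖f w ^ 2 ^ k₀‖ < M ^ 2 ^ k₀ := hw
    obtain ⟨j, rfl⟩ := Nat.exists_eq_add_of_le hk
    rw [pow_add, pow_mul, pow_mul]
    exact (norm_pow_le' _ (by positivity)).trans_lt
      (pow_lt_pow_left₀ hw' (norm_nonneg _) (by positivity))

/-- A three circles theorem for the spectral radius, for circles of reciprocal radii. The functions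
`f z` and `f z⁻¹` exchange the two boundary circles, so that the maximum principle applies to a
product of matrix coefficients of their large powers. -/
theorem specRad_sq_le_of_circles {f : ℂ → B} (hf : DifferentiableOn ℂ f {0}ᶜ) {R M₁ M₂ : ℝ}
    (hR : 1 < R) (h₁ : ∀ z : ℂ, ‖z‖ = R⁻¹ → specRad (f z) < M₁)
    (h₂ : ∀ z : ℂ, ‖z‖ = R → specRad (f z) < M₂) : specRad (f 1) ^ 2 ≤ M₁ * M₂ := by
  have hR0 : 0 < R := one_pos.trans hR
  have hRi : 0 < R⁻¹ := inv_pos.2 hR0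
  have hRR : R⁻¹ < 1 := inv_lt_one_of_one_lt₀ hR
  have hM₁ : 0 < M₁ := (specRad_nonneg _).trans_lt (h₁ (R⁻¹ : ℝ) (by simp [abs_of_pos hR0]))
  have hM₂ : 0 < M₂ := (specRad_nonneg _).trans_lt (h₂ (R : ℝ) (by simp [abs_of_pos hR0]))
  have hsphere : ∀ ρ : ℝ, 0 < ρ → Metric.sphere (0 : ℂ) ρ ⊆ {0}ᶜ := by
    rintro ρ hρ z hz rfl
    simp at hz
    exact hρ.ne hz
  obtain ⟨k₁, hk₁⟩ := exists_forall_norm_pow_lt (isCompact_sphere (0 : ℂ) R⁻¹)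
    (hf.continuousOn.mono (hsphere _ hRi)) (M := M₁) (fun z hz => h₁ z (by simpa using hz))
  obtain ⟨k₂, hk₂⟩ := exists_forall_norm_pow_lt (isCompact_sphere (0 : ℂ) R)
    (hf.continuousOn.mono (hsphere _ hR0)) (M := M₂) (fun z hz => h₂ z (by simpa using hz))
  set n := 2 ^ max k₁ k₂ with hn
  have hn0 : n ≠ 0 := by positivity
  have H₁ : ∀ z : ℂ, ‖z‖ = R⁻¹ → ‖f z ^ n‖ ≤ M₁ ^ n := fun z hz =>
    (hk₁ _ (le_max_left _ _) z (by simpa using hz)).le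
  have H₂ : ∀ z : ℂ, ‖z‖ = R → ‖f z ^ n‖ ≤ M₂ ^ n := fun z hz =>
    (hk₂ _ (le_max_right _ _) z (by simpa using hz)).le
  obtain ⟨φ, hφ, hφ1⟩ := exists_dual_vector'' ℂ (f 1 ^ n)
  have hφle : ∀ x, ‖φ x‖ ≤ ‖x‖ := fun x => by
    simpa using φ.le_of_opNorm_le hφ x
  set U : Set ℂ := {z | R⁻¹ < ‖z‖ ∧ ‖z‖ < R} with hU
  set F : ℂ → ℂ := fun z => φ (f z ^ n) * φ (f z⁻¹ ^ n) with hF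
  have hUo : IsOpen U :=
    (isOpen_lt continuous_const continuous_norm).inter (isOpen_lt continuous_norm continuous_const)
  have hclos : closure U ⊆ {z | R⁻¹ ≤ ‖z‖ ∧ ‖z‖ ≤ R} := by
    refine closure_minimal (fun z hz => ⟨hz.1.le, hz.2.le⟩) ?_
    exact (isClosed_le continuous_const continuous_norm).inter
      (isClosed_le continuous_norm continuous_const)
  have hfr : ∀ z ∈ frontier U, ‖z‖ = R⁻¹ ∨ ‖z‖ = R := by
    intro z hz
    have hz1 := hclos hz.1
    have hz2 : z ∉ U := fun h => hz.2 (hUo.interior_eq.symm ▸ h)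
    by_contra! hne
    exact hz2 ⟨lt_of_le_of_ne hz1.1 (Ne.symm hne.1), lt_of_le_of_ne hz1.2 hne.2⟩
  have hFd : DifferentiableOn ℂ F {0}ᶜ := by
    have hinv : DifferentiableOn ℂ (fun z : ℂ => f z⁻¹) {0}ᶜ :=
      hf.comp (differentiableOn_inv.mono fun z hz => hz) (fun z hz => by simpa using hz)
    exact (φ.differentiable.comp_differentiableOn (hf.pow n)).mul
      (φ.differentiable.comp_differentiableOn (hinv.pow n))
  have hFU : DiffContOnCl ℂ F U := by
    refine DifferentiableOn.diffContOnCl (hFd.mono fun z hz => ?_)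
    rintro rfl
    have := (hclos hz).1
    simp at this
    linarith
  have hbd : Bornology.IsBounded U :=
    Metric.isBounded_ball.subset (fun z hz => by simpa using hz.2 : U ⊆ Metric.ball 0 R)
  have hFle : ∀ z ∈ frontier U, ‖F z‖ ≤ M₁ ^ n * M₂ ^ n := by
    intro z hz
    rw [hF, norm_mul]
    rcases hfr z hz with h | h
    · exact mul_le_mul ((hφle _).trans (H₁ z h)) ((hφle _).trans (H₂ _ (by simp [h])))
        (norm_nonneg _) (by positivity)
    · rw [mul_comm (M₁ ^ n)]
      exact mul_le_mul ((hφle _).trans (H₂ z h)) ((hφle _).trans (H₁ _ (by simp [h])))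
        (norm_nonneg _) (by positivity)
  have h1 := Complex.norm_le_of_forall_mem_frontier_norm_le hbd hFU hFle (z := 1)
    (subset_closure (by simp [hU, hRR, hR]))
  rw [hF] at h1
  simp only [inv_one, hφ1, norm_mul] at h1
  have h2 := specRad_pow_le_norm_pow (f 1) hn0
  have h3 : (specRad (f 1) ^ 2) ^ n ≤ (M₁ * M₂) ^ n := by
    calc (specRad (f 1) ^ 2) ^ n = specRad (f 1) ^ n * specRad (f 1) ^ n := by ring
      _ ≤ ‖f 1 ^ n‖ * ‖f 1 ^ n‖ :=
        mul_le_mul h2 h2 (pow_nonneg (specRad_nonneg _) _) (norm_nonneg _)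
      _ ≤ M₁ ^ n * M₂ ^ n := by simpa using h1
      _ = (M₁ * M₂) ^ n := (mul_pow _ _ _).symm
  exact le_of_pow_le_pow_left₀ hn0 (by positivity) h3

lemma le_mul_of_forall_pos_add {x a b : ℝ} (h : ∀ ε > 0, x ≤ (a + ε) * (b + ε)) : x ≤ a * b := by
  have hc : Tendsto (fun ε : ℝ => (a + ε) * (b + ε)) (𝓝[>] 0) (𝓝 (a * b)) := by
    have : Continuous fun ε : ℝ => (a + ε) * (b + ε) := by fun_prop
    simpa using (this.tendsto 0).mono_left nhdsWithin_le_nhds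
  exact ge_of_tendsto hc (eventually_mem_nhdsWithin.mono h)

/-- Liouville's theorem for the spectral radius. -/
theorem specRad_eq_of_differentiable_of_bounded {f : ℂ → B} (hf : Differentiable ℂ f) {M : ℝ}
    (hM : ∀ z, specRad (f z) ≤ M) (z w : ℂ) : specRad (f z) = specRad (f w) := by
  have key : ∀ M, (∀ z, specRad (f z) ≤ M) → ∀ z w, specRad (f z) ^ 2 ≤ specRad (f w) * M := by
    intro M hM z w
    refine le_mul_of_forall_pos_add fun ε hε => ?_
    set g : ℂ → B := fun t => f (w + t * (z - w)) with hg
    have hgd : Differentiable ℂ g := hf.comp (by fun_prop)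
    have h0 : ∀ᶠ t in 𝓝 (0 : ℂ), specRad (g t) < specRad (f w) + ε := by
      have hgc : Tendsto g (𝓝 0) (𝓝 (f w)) := by
        simpa [hg] using hgd.continuous.tendsto 0
      exact hgc.eventually (eventually_specRad_lt (lt_add_of_pos_right _ hε))
    obtain ⟨δ, hδ, hball⟩ := Metric.eventually_nhds_iff.1 h0
    obtain ⟨R, hR⟩ := exists_gt (max 1 δ⁻¹)
    have hR1 := (le_max_left _ _).trans_lt hR
    have hRδ := (le_max_right _ _).trans_lt hR
    have := specRad_sq_le_of_circles hgd.differentiableOn hR1 (M₁ := specRad (f w) + ε)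
      (M₂ := M + ε) (fun t ht => hball (by simpa [ht] using inv_lt_of_inv_lt₀ hδ hRδ))
      (fun t _ => (hM _).trans_lt (lt_add_of_pos_right _ hε))
    simpa [hg] using this
  have hbdd : BddAbove (Set.range fun z => specRad (f z)) := ⟨M, by rintro _ ⟨z, rfl⟩; exact hM z⟩
  set s := ⨆ z, specRad (f z) with hs
  have hle : ∀ z, specRad (f z) ≤ s := fun z => le_ciSup hbdd z
  have hs0 : 0 ≤ s := (specRad_nonneg _).trans (hle 0)
  have hge : ∀ w, s ≤ specRad (f w) := by
    intro w
    rcases hs0.eq_or_lt with h | h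
    · rw [← h]; exact specRad_nonneg _
    · have h2 : s ≤ √(specRad (f w) * s) :=
        ciSup_le fun z => Real.le_sqrt_of_sq_le (key s hle z w)
      have h3 : s ^ 2 ≤ specRad (f w) * s :=
        (Real.le_sqrt hs0 (mul_nonneg (specRad_nonneg _) hs0)).1 h2
      nlinarith
  exact ((hle z).trans (hge w)).antisymm ((hle w).trans (hge z))

end SpecRad

/-! ### Irreducible representations, the radical and characters -/

section Schur
variable {B : Type*} [NormedRing B] [NormedAlgebra ℂ B] [CompleteSpace B]

/-- Schur's lemma for Banach algebras: the commutant of an irreducible representation consists of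
the scalars. Every endomorphism is automatically bounded, since it is induced by a right
multiplication, and so its spectrum is nonempty. -/
theorem exists_eq_smul_of_isMaximal (L : Ideal B) [hL : L.IsMaximal] (u : (B ⧸ L) →ₗ[B] (B ⧸ L)) :
    ∃ c : ℂ, ∀ x, u x = c • x := by
  have : IsSimpleModule B (B ⧸ L) := isSimpleModule_iff_isCoatom.2 (Ideal.isMaximal_def.1 hL)
  have : Nontrivial (B ⧸ L) := IsSimpleModule.nontrivial B _
  have hcl : IsClosed (L : Set B) := Ideal.IsMaximal.isClosed
  obtain ⟨d, hd⟩ := Submodule.Quotient.mk_surjective L (u (Submodule.Quotient.mk 1))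
  have hu : ∀ b : B, u (Submodule.Quotient.mk b) = Submodule.Quotient.mk (b * d) := by
    intro b
    have h1 : (Submodule.Quotient.mk b : B ⧸ L) = b • Submodule.Quotient.mk 1 := by
      rw [← Submodule.Quotient.mk_smul, smul_eq_mul, mul_one]
    rw [h1, map_smul, ← hd, ← Submodule.Quotient.mk_smul, smul_eq_mul]
  have hcont : Continuous u := by
    have hq : IsQuotientMap (Submodule.Quotient.mk : B → B ⧸ L) := isQuotientMap_quotient_mk'
    refine hq.continuous_iff.2 ?_
    have : (u ∘ Submodule.Quotient.mk) = fun b : B => (Submodule.Quotient.mk (b * d) : B ⧸ L) :=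
      funext hu
    rw [this]
    exact hq.continuous.comp (by fun_prop)
  let v : (B ⧸ L) →L[ℂ] (B ⧸ L) := ⟨u.restrictScalars ℂ, hcont⟩
  obtain ⟨c, hc⟩ := spectrum.nonempty v
  refine ⟨c, fun x => ?_⟩
  have hns : ∀ (b : B) (x : B ⧸ L), c • b • x = b • c • x := fun b x => smul_comm c b x
  let w : (B ⧸ L) →ₗ[B] (B ⧸ L) :=
    { toFun := fun x => c • x - u x
      map_add' := fun x y => by rw [smul_add, map_add]; abel
      map_smul' := fun b x => by simp only [map_smul, RingHom.id_apply, smul_sub, hns] }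
  rcases LinearMap.bijective_or_eq_zero w with hw | hw
  · refine absurd ?_ hc
    have hwv : ⇑(algebraMap ℂ ((B ⧸ L) →L[ℂ] (B ⧸ L)) c - v) = w := by
      ext x
      simp only [Algebra.algebraMap_eq_smul_one, v, w]
      rfl
    rw [← hwv] at hw
    exact ContinuousLinearMap.isUnit_iff_bijective.2 hw
  · have := LinearMap.congr_fun hw x
    exact (sub_eq_zero.1 this).symm

/-- The density theorem for two vectors of an irreducible representation. -/
theorem exists_smul_eq_zero_and_smul_eq (L : Ideal B) [hL : L.IsMaximal] {ξ η : B ⧸ L} (hξ : ξ ≠ 0)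
    (h : ∀ c : ℂ, η ≠ c • ξ) : ∃ y : B, y • ξ = 0 ∧ y • η = ξ := by
  have hs : IsSimpleModule B (B ⧸ L) := isSimpleModule_iff_isCoatom.2 (Ideal.isMaximal_def.1 hL)
  have hsurj : ∀ x : B ⧸ L, x ≠ 0 → Function.Surjective (LinearMap.toSpanSingleton B (B ⧸ L) x) :=
    fun x hx => IsSimpleModule.toSpanSingleton_surjective B hx
  by_cases hy : ∃ y : B, y • ξ = 0 ∧ y • η ≠ 0
  · obtain ⟨y, hy1, hy2⟩ := hy
    obtain ⟨w, hw⟩ := hsurj _ hy2 ξ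
    refine ⟨w * y, ?_, ?_⟩
    · rw [mul_smul, hy1, smul_zero]
    · rw [mul_smul]; exact hw
  · push Not at hy
    -- `b • ξ ↦ b • η` is a well-defined endomorphism, hence a scalar
    let f := LinearMap.toSpanSingleton B (B ⧸ L) ξ
    let g := LinearMap.toSpanSingleton B (B ⧸ L) η
    have hker : LinearMap.ker f ≤ LinearMap.ker g := fun y hy' => hy y hy'
    let u := ((LinearMap.ker f).liftQ g hker).comp
      (f.quotKerEquivOfSurjective (hsurj ξ hξ)).symm.toLinearMap
    obtain ⟨c, hc⟩ := exists_eq_smul_of_isMaximal L u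
    refine absurd ?_ (h c)
    rw [← hc ξ]
    have h1 : (f.quotKerEquivOfSurjective (hsurj ξ hξ)).symm ξ = Submodule.Quotient.mk 1 := by
      rw [LinearEquiv.symm_apply_eq]
      simp [f]
    simp [u, h1, g]

/-- Zemánek's criterion for membership in the radical. If `b ξ` is not a multiple of `ξ` in some
irreducible representation, then `b` has a conjugate whose difference from `b` has a nonzero
eigenvalue, although the hypothesis makes this difference quasinilpotent. -/
theorem mem_jacobson_of_specRad_add_le {b : B} (h : ∀ z, specRad (b + z) ≤ specRad z) :
    b ∈ Ring.jacobson B := by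
  have h0 : specRad (0 : B) = 0 := by simp [specRad]
  -- the difference of `b` and any of its conjugates is quasinilpotent
  have hconj : ∀ u : Bˣ, specRad (u * b * ↑u⁻¹ - b) = 0 := by
    intro u
    refine le_antisymm ?_ (specRad_nonneg _)
    rw [← specRad_neg, neg_sub, sub_eq_add_neg]
    refine (h _).trans ?_
    rw [specRad_neg, specRad_units_conj]
    simpa [h0] using h 0
  rw [Ring.jacobson_eq_sInf_isMaximal, Submodule.mem_sInf]
  intro L hL'
  have hL : Ideal.IsMaximal L := hL'
  have : Nontrivial (B ⧸ L) :=
    (isSimpleModule_iff_isCoatom.2 (Ideal.isMaximal_def.1 hL)).nontrivial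
  -- a quasinilpotent element has no nonzero eigenvalue in the representation on `B ⧸ L`
  have heig : ∀ (a : B) (c : ℂ) (ξ : B ⧸ L), specRad a = 0 → ξ ≠ 0 → a • ξ = c • ξ → c = 0 := by
    intro a c ξ ha hξ hac
    have hc : c ∈ spectrum ℂ a := by
      intro hu
      have h1 : (algebraMap ℂ B c - a) • ξ = 0 := by
        rw [sub_smul, hac, algebraMap_smul, sub_self]
      obtain ⟨v, hv⟩ := hu
      refine hξ ?_
      rw [← one_smul B ξ, ← v.inv_mul, mul_smul, hv, h1, smul_zero]
    have := norm_le_specRad_of_mem hc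
    rw [ha] at this
    exact norm_le_zero_iff.1 this
  have hb0 : specRad b = 0 := le_antisymm (by simpa [h0] using h 0) (specRad_nonneg _)
  have hact : ∀ ξ : B ⧸ L, b • ξ = 0 := by
    intro ξ
    by_contra hne
    have hξ : ξ ≠ 0 := by rintro rfl; simp at hne
    by_cases hdep : ∃ c : ℂ, b • ξ = c • ξ
    · obtain ⟨c, hc⟩ := hdep
      refine hne ?_
      rw [hc, heig b c ξ hb0 hξ hc, zero_smul]
    · push Not at hdep
      obtain ⟨y, hy1, hy2⟩ := exists_smul_eq_zero_and_smul_eq L hξ hdep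
      -- conjugating by the unit `1 - ε y`, with `ε` small, moves `b` so that `ξ` becomes an
      -- eigenvector of the difference, with eigenvalue `-ε`
      obtain ⟨ε, hε, hεy⟩ : ∃ ε : ℝ, 0 < ε ∧ ε * ‖y‖ < 1 := by
        refine ⟨(‖y‖ + 1)⁻¹, by positivity, ?_⟩
        rw [inv_mul_lt_one₀ (by positivity)]
        exact lt_add_one _
      have hnorm : ‖(ε : ℂ) • y‖ < 1 := by
        rwa [norm_smul, Complex.norm_real, Real.norm_of_nonneg hε.le]
      let u := Units.oneSub ((ε : ℂ) • y) hnorm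
      have hu : (u : B) = 1 - (ε : ℂ) • y := rfl
      have huξ : (u : B) • ξ = ξ := by
        rw [hu, sub_smul, one_smul, smul_assoc, hy1, smul_zero, sub_zero]
      have huξ' : (↑u⁻¹ : B) • ξ = ξ := by
        conv_lhs => rw [← huξ]
        rw [← mul_smul, u.inv_mul, one_smul]
      have key : ((u : B) * b * ↑u⁻¹ - b) • ξ = (-ε : ℂ) • ξ := by
        rw [sub_smul, mul_smul, mul_smul, huξ', hu, sub_smul, one_smul, smul_assoc, hy2, neg_smul]
        abel
      have := heig _ _ ξ (hconj u) hξ key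
      simp [hε.ne'] at this
  have := hact (Submodule.Quotient.mk 1)
  rwa [← Submodule.Quotient.mk_smul, smul_eq_mul, mul_one, Submodule.Quotient.mk_eq_zero] at this

/-- If all commutators lie in the radical, then every element which is not invertible is
annihilated by a character. -/
theorem exists_algHom_apply_eq_zero {R : Type*} [NormedRing R] [NormedAlgebra ℂ R] [CompleteSpace R]
    (hR : ∀ u v : R, u * v - v * u ∈ Ring.jacobson R) {w : R} (hw : ¬ IsUnit w) :
    ∃ ψ : R →ₐ[ℂ] ℂ, ψ w = 0 := by
  have hjac : ∀ j ∈ Ring.jacobson R, ∃ x, x * (1 + j) = 1 := by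
    intro j hj
    by_contra hne
    have hspan : Ideal.span {1 + j} ≠ ⊤ := by
      intro htop
      exact hne (Ideal.mem_span_singleton'.1 ((Ideal.eq_top_iff_one _).1 htop))
    obtain ⟨L, hL, hle⟩ := Ideal.exists_le_maximal _ hspan
    have h1 : 1 + j ∈ L := hle (Ideal.mem_span_singleton_self _)
    have h2 : j ∈ L := Ring.jacobson_le_of_isMaximal L hj
    exact hL.ne_top ((Ideal.eq_top_iff_one _).2 (by simpa using L.sub_mem h1 h2))
  have hspan : Ideal.span {w} ≠ ⊤ := by
    intro htop
    obtain ⟨v, hv⟩ := Ideal.mem_span_singleton'.1 ((Ideal.eq_top_iff_one _).1 htop)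
    obtain ⟨x, hx⟩ := hjac _ (hR w v)
    rw [hv] at hx
    -- `w * v` is an idempotent with a left inverse
    have hx' : x * (w * v) = 1 := by rw [← hx]; congr 1; abel
    have hwv : w * v = 1 := by
      calc w * v = x * (w * v) * (w * v) := by rw [hx', one_mul]
        _ = x * (w * (v * w) * v) := by simp only [mul_assoc]
        _ = 1 := by rw [hv, mul_one, hx']
    exact hw ⟨⟨w, v, hwv, hv⟩, rfl⟩
  obtain ⟨L, hL, hle⟩ := Ideal.exists_le_maximal _ hspan
  have : L.IsTwoSided := ⟨fun {a} b ha => by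
    have h1 := Ring.jacobson_le_of_isMaximal L (hR a b)
    simpa using L.add_mem h1 (L.mul_mem_left b ha)⟩
  have : Nontrivial (R ⧸ L) := Ideal.Quotient.nontrivial_iff.2 hL.ne_top
  have hbij : Function.Bijective (Algebra.ofId ℂ (R ⧸ L)) := by
    refine ⟨(algebraMap ℂ (R ⧸ L)).injective, fun x => ?_⟩
    obtain ⟨y, rfl⟩ := Ideal.Quotient.mk_surjective x
    let u : (R ⧸ L) →ₗ[R] (R ⧸ L) := Submodule.mapQ L L (LinearMap.toSpanSingleton R R y)
      (fun b hb => by simpa using L.mul_mem_right y hb)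
    obtain ⟨c, hc⟩ := exists_eq_smul_of_isMaximal L u
    refine ⟨c, ?_⟩
    have h1 : u (Submodule.Quotient.mk 1) = Submodule.Quotient.mk y := by
      simp only [u, Submodule.mapQ_apply, LinearMap.toSpanSingleton_apply, one_smul]
    rw [hc] at h1
    rw [Algebra.ofId_apply, Algebra.algebraMap_eq_smul_one]
    exact h1
  refine ⟨(AlgEquiv.ofBijective _ hbij).symm.toAlgHom.comp (Ideal.Quotient.mkₐ ℂ L), ?_⟩
  have h0 : Ideal.Quotient.mk L w = 0 :=
    Ideal.Quotient.eq_zero_iff_mem.2 (hle (Ideal.mem_span_singleton_self _))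
  simp [h0]

end Schur

/-! ### Injectivity and continuity of spectral isometries; characters and subadditivity -/

section Continuity
variable {A B : Type*} [NormedRing A] [NormedAlgebra ℂ A] [CompleteSpace A]
  [NormedRing B] [NormedAlgebra ℂ B] [CompleteSpace B]

omit [CompleteSpace B] in
/-- A spectral isometry on a semisimple Banach algebra is injective. -/
theorem injective_of_specRad_eq (hA : IsJacobsonSemisimple A) {T : A →ₗ[ℂ] B}
    (hT : ∀ a, specRad (T a) = specRad a) : Function.Injective T := by
  refine (injective_iff_map_eq_zero T).2 fun a ha => ?_
  have h : a ∈ Ring.jacobson A := mem_jacobson_of_specRad_add_le fun z => by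
    rw [← hT, map_add, ha, zero_add, hT]
  rw [hA] at h
  exact h

/-- A spectral isometry onto a semisimple Banach algebra is continuous. If `xₙ → 0` and
`T xₙ → b = T a`, then the three circles theorem, applied to `T (z + a - xₙ) + λ T xₙ` on the circles
of radii `R⁻¹` (where this is close to `T z`) and `R` (where its argument is close to `z + a`),
shows that `b` belongs to the radical. -/
theorem continuous_of_specRad_eq (hB : IsJacobsonSemisimple B) {T : A →ₗ[ℂ] B}
    (hT : ∀ a, specRad (T a) = specRad a) (hsurj : Function.Surjective T) : Continuous T := by
  refine T.continuous_of_seq_closed_graph fun u x y hu hTu => ?_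
  obtain ⟨a, ha⟩ := hsurj (y - T x)
  rw [← sub_eq_zero, ← ha]
  have hx0 : Tendsto (fun n => u n - x) atTop (𝓝 0) := by
    simpa using hu.sub_const x
  have hTx : Tendsto (fun n => T (u n - x)) atTop (𝓝 (T a)) := by
    rw [ha]; simpa using hTu.sub_const (T x)
  generalize hv : (fun n => u n - x) = v at hx0
  have hvn : ∀ n, u n - x = v n := fun n => congrFun hv n
  simp only [hvn] at hTx
  have h : T a ∈ Ring.jacobson B := by
    refine mem_jacobson_of_specRad_add_le fun w => ?_
    obtain ⟨z, rfl⟩ := hsurj w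
    have key : specRad (T a + T z) ^ 2 ≤ specRad (T z) * specRad (T a + T z) := by
      refine le_mul_of_forall_pos_add fun ε hε => ?_
      obtain ⟨δ₁, hδ₁, hball₁⟩ := Metric.eventually_nhds_iff.1
        (eventually_specRad_lt (lt_add_of_pos_right (specRad (T z)) hε))
      obtain ⟨δ₂, hδ₂, hball₂⟩ := Metric.eventually_nhds_iff.1
        (eventually_specRad_lt (lt_add_of_pos_right (specRad (a + z)) hε))
      obtain ⟨R, hR⟩ := exists_gt (max 1 (‖T a‖ / δ₁))
      have hR1 : 1 < R := (le_max_left _ _).trans_lt hR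
      have hR0 : 0 < R := one_pos.trans hR1
      have hRδ : R⁻¹ * ‖T a‖ < δ₁ := by
        have := (le_max_right _ _).trans_lt hR
        rw [div_lt_iff₀ hδ₁] at this
        rwa [inv_mul_lt_iff₀ hR0]
      have hlim₁ : Tendsto (fun n => ‖T a - T (v n)‖ + R⁻¹ * ‖T (v n)‖) atTop
          (𝓝 (R⁻¹ * ‖T a‖)) := by
        simpa using (hTx.const_sub (T a)).norm.add (hTx.norm.const_mul R⁻¹)
      have hlim₂ : Tendsto (fun n => ‖v n‖ + R * ‖v n‖) atTop (𝓝 0) := by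
        simpa using hx0.norm.add (hx0.norm.const_mul R)
      obtain ⟨n, hn₁, hn₂⟩ :=
        ((hlim₁.eventually_lt_const hRδ).and (hlim₂.eventually_lt_const hδ₂)).exists
      let f : ℂ → B := fun c => T (z + a - v n) + c • T (v n)
      have hf : Differentiable ℂ f := by
        simp only [f]
        fun_prop
      have hc := specRad_sq_le_of_circles (f := f) hf.differentiableOn hR1
        (M₁ := specRad (T z) + ε) (M₂ := specRad (a + z) + ε)
        (fun c hc => hball₁ (by
          refine lt_of_le_of_lt ?_ hn₁
          rw [dist_eq_norm]
          have : f c - T z = (T a - T (v n)) + c • T (v n) := by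
            simp only [f, map_sub, map_add]; abel
          rw [this, ← hc, ← norm_smul]
          exact norm_add_le _ _))
        (fun c hc => by
          have hfc : f c = T (z + a - v n + c • v n) := by simp [f]
          rw [hfc, hT]
          refine hball₂ (lt_of_le_of_lt ?_ hn₂)
          rw [dist_eq_norm]
          have : z + a - v n + c • v n - (a + z) = -v n + c • v n := by abel
          rw [this, ← hc, ← norm_smul]
          exact (norm_add_le _ _).trans_eq (by rw [norm_neg]))
      have hf1 : f 1 = T a + T z := by
        simp only [f, map_sub, map_add, one_smul]; abel
      have hs : specRad (a + z) = specRad (T a + T z) := by rw [← map_add, hT]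
      rwa [hf1, hs] at hc
    rcases (specRad_nonneg (T a + T z)).eq_or_lt with h0 | h0
    · rw [← h0]; exact specRad_nonneg _
    · nlinarith
  rw [hB] at h
  exact h

end Continuity

section Commutative
variable {C R : Type*} [NormedRing C] [NormedAlgebra ℂ C] [CompleteSpace C]
  [NormedRing R] [NormedAlgebra ℂ R] [CompleteSpace R]

lemma norm_algHom_apply_le_specRad (χ : C →ₐ[ℂ] ℂ) (a : C) : ‖χ a‖ ≤ specRad a :=
  norm_le_specRad_of_mem (AlgHom.apply_mem_spectrum χ a)

/-- If all commutators lie in the radical, then the spectral radius of an element is attained by a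
character. -/
lemma exists_norm_algHom_apply_eq_specRad [Nontrivial C]
    (hC : ∀ u v : C, u * v - v * u ∈ Ring.jacobson C) (a : C) :
    ∃ χ : C →ₐ[ℂ] ℂ, ‖χ a‖ = specRad a := by
  obtain ⟨c, hc, hca⟩ := exists_mem_spectrum_norm_eq a
  obtain ⟨χ, hχ⟩ := exists_algHom_apply_eq_zero hC hc
  refine ⟨χ, ?_⟩
  rw [map_sub, AlgHom.commutes, sub_eq_zero] at hχ
  rw [← hca, ← hχ]
  simp

lemma specRad_add_le (hC : ∀ u v : C, u * v - v * u ∈ Ring.jacobson C) (a b : C) :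
    specRad (a + b) ≤ specRad a + specRad b := by
  rcases subsingleton_or_nontrivial C with _ | _
  · simp [Subsingleton.elim a 0, Subsingleton.elim b 0, specRad]
  obtain ⟨χ, hχ⟩ := exists_norm_algHom_apply_eq_specRad hC (a + b)
  rw [← hχ, map_add]
  exact (norm_add_le _ _).trans
    (add_le_add (norm_algHom_apply_le_specRad χ a) (norm_algHom_apply_le_specRad χ b))

end Commutative

/-! ### Commutativity modulo the radical and Nagasawa's theorem -/

section Exponential
variable {R : Type*} [NormedRing R] [NormedAlgebra ℂ R] [CompleteSpace R]

lemma exp_add_of_commute_complex {u v : R} (h : Commute u v) :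
    NormedSpace.exp (u + v) = NormedSpace.exp u * NormedSpace.exp v :=
  letI := NormedAlgebra.restrictScalars ℚ ℂ R
  NormedSpace.exp_add_of_commute h

/-- The exponential of an element of a Banach algebra, as a unit. -/
noncomputable def expUnit (u : R) : Rˣ where
  val := NormedSpace.exp u
  inv := NormedSpace.exp (-u)
  val_inv := by
    rw [← exp_add_of_commute_complex (Commute.refl u).neg_right, add_neg_cancel,
      NormedSpace.exp_zero]
  inv_val := by
    rw [← exp_add_of_commute_complex (Commute.refl u).neg_left, neg_add_cancel,
      NormedSpace.exp_zero]

lemma expUnit_zero : expUnit (0 : R) = 1 := Units.ext NormedSpace.exp_zero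

lemma expUnit_add_self (u : R) : expUnit (u + u) = expUnit u * expUnit u :=
  Units.ext (exp_add_of_commute_complex (Commute.refl u))

lemma hasDerivAt_expUnit_smul (u : R) :
    HasDerivAt (fun c : ℂ => (expUnit (c • u) : R)) u 0 := by
  simpa using! hasDerivAt_exp_smul_const u (0 : ℂ)

lemma expUnit_smul_inv (u : R) (c : ℂ) :
    (↑(expUnit (c • u))⁻¹ : R) = expUnit (c • -u) := by
  rw [smul_neg]; rfl

lemma differentiable_expUnit_smul (u : R) :
    Differentiable ℂ (fun c : ℂ => (expUnit (c • u) : R)) :=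
  differentiable_exp_smul_const ℂ u

lemma differentiable_expUnit_conj (u v : R) :
    Differentiable ℂ fun c : ℂ => (expUnit (c • u) * v * ↑(expUnit (c • u))⁻¹ : R) := by
  simp only [expUnit_smul_inv]
  exact ((differentiable_expUnit_smul u).mul_const v).mul (differentiable_expUnit_smul (-u))

lemma hasDerivAt_expUnit_conj (u v : R) :
    HasDerivAt (fun c : ℂ => (expUnit (c • u) * v * ↑(expUnit (c • u))⁻¹ : R))
      (u * v - v * u) 0 := by
  simp only [expUnit_smul_inv]
  convert! ((hasDerivAt_expUnit_smul u).mul_const v).mul (hasDerivAt_expUnit_smul (-u)) using 1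
  simp [expUnit_zero, sub_eq_add_neg]

/-- A Banach algebra whose spectral radius is subadditive is commutative modulo its radical. -/
theorem commutator_mem_jacobson_of_specRad_add_le
    (h : ∀ a b : R, specRad (a + b) ≤ specRad a + specRad b) (u v : R) :
    u * v - v * u ∈ Ring.jacobson R := by
  set f : ℂ → R := fun c => expUnit (c • u) * v * ↑(expUnit (c • u))⁻¹ with hf
  set g : ℂ → R := dslope f 0 with hg
  have hfd : Differentiable ℂ f := differentiable_expUnit_conj u v
  have hgd : Differentiable ℂ g := by
    rw [← differentiableOn_univ] at hfd ⊢
    exact (Complex.differentiableOn_dslope univ_mem).2 hfd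
  have hf0 : f 0 = v := by simp [hf, expUnit_zero]
  have hfr : ∀ c, specRad (f c) = specRad v := fun c => specRad_units_conj _ _
  have hg0 : g 0 = u * v - v * u := by
    rw [hg, dslope_same]
    exact (hasDerivAt_expUnit_conj u v).deriv
  have hgr : ∀ c ≠ 0, specRad (g c) ≤ ‖c‖⁻¹ * (2 * specRad v) := by
    intro c hc
    rw [hg, dslope_of_ne f hc, slope_def_module, sub_zero, hf0, specRad_smul, norm_inv,
      sub_eq_add_neg]
    gcongr
    refine (h _ _).trans_eq ?_
    rw [hfr, specRad_neg, two_mul]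
  obtain ⟨K, hK⟩ := (isCompact_closedBall (0 : ℂ) 1).exists_bound_of_continuousOn
    hgd.continuous.continuousOn
  have hbd : ∀ c, specRad (g c) ≤ max K (2 * specRad v) := by
    intro c
    rcases le_total ‖c‖ 1 with hc | hc
    · exact ((specRad_le_norm _).trans (hK c (by simpa using hc))).trans (le_max_left _ _)
    · have hc0 : c ≠ 0 := by rintro rfl; norm_num at hc
      refine ((hgr c hc0).trans ?_).trans (le_max_right _ _)
      exact mul_le_of_le_one_left (mul_nonneg zero_le_two (specRad_nonneg v))
        (inv_le_one_of_one_le₀ hc)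
  have hzero : specRad (u * v - v * u) = 0 := by
    refine le_antisymm ?_ (specRad_nonneg _)
    have hlim : Tendsto (fun n : ℕ => ((n : ℝ))⁻¹ * (2 * specRad v)) atTop (𝓝 0) := by
      simpa using (tendsto_inv_atTop_nhds_zero_nat (𝕜 := ℝ)).mul_const (2 * specRad v)
    refine ge_of_tendsto hlim ?_
    filter_upwards [eventually_gt_atTop 0] with n hn
    rw [← hg0, specRad_eq_of_differentiable_of_bounded hgd hbd 0 n]
    simpa using hgr n (by simpa using hn.ne')
  refine mem_jacobson_of_specRad_add_le fun z => ?_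
  simpa [hzero] using h (u * v - v * u) z

end Exponential

section Smooth
variable {E : Type*} [NormedAddCommGroup E] [NormedSpace ℝ E] [NormedSpace ℂ E]
  [IsScalarTower ℝ ℂ E]

/-- A linear functional which is dominated by `N` in absolute value and attains `N` at a point of
differentiability is a support functional, so it is determined by the derivative. -/
lemma fderiv_eq_re_of_norm_le {N : E → ℝ} {v : E} (hN : DifferentiableAt ℝ N v)
    {f : E →ₗ[ℂ] ℂ} (hf : ∀ w, ‖f w‖ ≤ N w) (hv : ‖f v‖ = N v) (h0 : N v ≠ 0) (w : E) :
    fderiv ℝ N v w = ((starRingEnd ℂ) (f v) / N v * f w).re := by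
  set k : ℂ := (starRingEnd ℂ) (f v) / N v with hk
  have hk1 : ‖k‖ = 1 := by
    rw [hk, norm_div, RCLike.norm_conj, Complex.norm_real, hv, Real.norm_eq_abs, ← hv, abs_norm,
      div_self (by rwa [hv])]
  have hkv : (k * f v).re = N v := by
    have : k * f v = (N v : ℂ) := by
      rw [hk, div_mul_eq_mul_div, ← Complex.normSq_eq_conj_mul_self, Complex.normSq_eq_norm_sq, hv]
      have : (N v : ℂ) ≠ 0 := by exact_mod_cast h0
      push_cast
      field_simp
    rw [this, Complex.ofReal_re]
  set φ : ℝ → ℝ := fun t => N (v + t • w) - (N v + t * (k * f w).re) with hφ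
  have hφd : HasDerivAt φ (fderiv ℝ N v w - (k * f w).re) 0 := by
    have h1 : HasDerivAt (fun t : ℝ => v + t • w) w 0 := by
      simpa using ((hasDerivAt_id (0 : ℝ)).smul_const w).const_add v
    have h2 : HasDerivAt (fun t : ℝ => N (v + t • w)) (fderiv ℝ N v w) 0 := by
      have h3 : HasFDerivAt N (fderiv ℝ N v) (v + (0 : ℝ) • w) := by
        simpa using hN.hasFDerivAt
      exact h3.comp_hasDerivAt 0 h1
    have h4 : HasDerivAt (fun t : ℝ => N v + t * (k * f w).re) (k * f w).re 0 := by
      simpa using ((hasDerivAt_id (0 : ℝ)).mul_const (k * f w).re).const_add (N v)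
    exact h2.sub h4
  have hmin : IsLocalMin φ 0 := by
    refine Eventually.of_forall fun t => ?_
    have h1 : (k * f (v + t • w)).re = N v + t * (k * f w).re := by
      have : f (t • w) = t * f w := by
        rw [← algebraMap_smul ℂ t w, map_smul, smul_eq_mul]; rfl
      rw [map_add, this, mul_add, Complex.add_re, hkv, mul_left_comm, Complex.re_ofReal_mul]
    have h2 : (k * f (v + t • w)).re ≤ N (v + t • w) := by
      refine (Complex.re_le_norm _).trans ?_
      rw [norm_mul, hk1, one_mul]
      exact hf _
    simp only [hφ]
    rw [← h1]
    simpa using h2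
  exact sub_eq_zero.1 (hmin.hasDerivAt_eq_zero hφd)

lemma linearMap_eq_of_differentiableAt {N : E → ℝ} {v : E} (hN : DifferentiableAt ℝ N v)
    (h0 : N v ≠ 0) {f g : E →ₗ[ℂ] ℂ} (hf : ∀ w, ‖f w‖ ≤ N w) (hfv : ‖f v‖ = N v)
    (hg : ∀ w, ‖g w‖ ≤ N w) (hgv : ‖g v‖ = N v) {e : E} (hfe : f e = 1) (hge : g e = 1) :
    f = g := by
  set k : ℂ := (starRingEnd ℂ) (f v) / N v with hk
  set l : ℂ := (starRingEnd ℂ) (g v) / N v with hl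
  have hre : ∀ w, (k * f w).re = (l * g w).re := fun w => by
    rw [hk, hl, ← fderiv_eq_re_of_norm_le hN hf hfv h0, fderiv_eq_re_of_norm_le hN hg hgv h0]
  have heq : ∀ w, k * f w = l * g w := by
    intro w
    refine Complex.ext (hre w) ?_
    have := hre (Complex.I • w)
    simp only [map_smul, smul_eq_mul, mul_left_comm _ Complex.I, Complex.I_mul_re, neg_inj] at this
    exact this
  have hkl : k = l := by simpa [hfe, hge] using heq e
  have hk0 : k ≠ 0 := by
    have hfv0 : f v ≠ 0 := by rw [← norm_ne_zero_iff, hfv]; exact h0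
    simp [hk, h0, hfv0]
  ext w
  have := heq w
  rw [← hkl] at this
  exact mul_left_cancel₀ hk0 this

end Smooth

section Nagasawa
variable {C R : Type*} [NormedRing C] [NormedAlgebra ℂ C] [CompleteSpace C]
  [NormedRing R] [NormedAlgebra ℂ R] [CompleteSpace R]

omit [NormedAlgebra ℂ C] [CompleteSpace C] in
lemma commutator_mem_jacobson_of_comm (hC : ∀ a b : C, a * b = b * a) (a b : C) :
    a * b - b * a ∈ Ring.jacobson C := by
  rw [hC a b, sub_self]; exact Submodule.zero_mem _

/-- The image of a commutative Banach algebra under a spectral isometry is commutative modulo its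
radical. -/
theorem commutator_mem_jacobson_of_specRad_eq (hC : ∀ a b : C, a * b = b * a) {T : C →ₗ[ℂ] R}
    (hsurj : Function.Surjective T) (hT : ∀ a, specRad (T a) = specRad a) (u v : R) :
    u * v - v * u ∈ Ring.jacobson R := by
  refine commutator_mem_jacobson_of_specRad_add_le (fun a b => ?_) u v
  obtain ⟨a, rfl⟩ := hsurj a
  obtain ⟨b, rfl⟩ := hsurj b
  rw [← map_add, hT, hT, hT]
  exact specRad_add_le (commutator_mem_jacobson_of_comm hC) a b

/-- A form of Nagasawa's theorem: a unital spectral isometry from a commutative Banach algebra onto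
a Banach algebra is multiplicative modulo the quasinilpotent elements. On the span of finitely many
elements, the spectral radius is a Lipschitz seminorm, so by Rademacher's theorem it is
differentiable on a dense set. At a point where it is differentiable the support functional is
unique, so that a character of `C` attaining the norm there and a character of `R` attaining the
norm at the image have to correspond to each other. -/
theorem specRad_map_mul_sub_eq_zero (hC : ∀ a b : C, a * b = b * a) {T : C →ₗ[ℂ] R}
    (h1 : T 1 = 1) (hsurj : Function.Surjective T) (hT : ∀ a, specRad (T a) = specRad a)
    (a b : C) : specRad (T (a * b) - T a * T b) = 0 := by
  have hCj := commutator_mem_jacobson_of_comm hC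
  have hRj := commutator_mem_jacobson_of_specRad_eq hC hsurj hT
  obtain ⟨d, hd⟩ := hsurj (T a * T b)
  rw [← hd, ← map_sub, hT]
  by_contra hne
  rcases subsingleton_or_nontrivial C with _ | _
  · exact hne (by simp [Subsingleton.elim (a * b - d) 0, specRad])
  rcases subsingleton_or_nontrivial R with _ | _
  · exact hne (by rw [← hT]; simp [Subsingleton.elim (T (a * b - d)) 0, specRad])
  let L : (Fin 5 → ℂ) →ₗ[ℂ] C := Fintype.linearCombination ℂ ![1, a, b, a * b, d]
  have hL : ∀ i, L (Pi.single i 1) = ![1, a, b, a * b, d] i := fun i => by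
    simp [L, Fintype.linearCombination_apply_single]
  set N : (Fin 5 → ℂ) → ℝ := fun w => specRad (L w) with hN
  obtain ⟨K, hK⟩ : ∃ K : NNReal, ∀ w, N w ≤ K * ‖w‖ :=
    ⟨‖LinearMap.toContinuousLinearMap L‖₊, fun w =>
      (specRad_le_norm _).trans ((LinearMap.toContinuousLinearMap L).le_opNorm w)⟩
  have hNsub : ∀ w w', N w ≤ N w' + N (w - w') := fun w w' => by
    have := specRad_add_le hCj (L w') (L (w - w'))
    rwa [← map_add, add_sub_cancel] at this
  have hNlip : LipschitzWith K N := LipschitzWith.of_le_add_mul K fun w w' => by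
    rw [dist_eq_norm]
    exact (hNsub w w').trans (add_le_add_right (hK _) _)
  have hdense : Dense {w | DifferentiableAt ℝ N w} :=
    MeasureTheory.Measure.dense_of_ae (hNlip.ae_differentiableAt (μ := MeasureTheory.volume))
  set v₀ : Fin 5 → ℂ := Pi.single 3 1 - Pi.single 4 1 with hv₀
  have hLv₀ : L v₀ = a * b - d := by rw [hv₀, map_sub, hL, hL]; rfl
  have hNv₀ : 0 < N v₀ := by
    simp only [hN, hLv₀]
    exact lt_of_le_of_ne (specRad_nonneg _) (Ne.symm hne)
  -- a point of differentiability `v` close to `v₀`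
  obtain ⟨v, hv, hvd⟩ : ∃ v, N (v - v₀) < N v₀ / 2 ∧ DifferentiableAt ℝ N v := by
    have hcont : Continuous fun v => N (v - v₀) := hNlip.continuous.comp (by fun_prop)
    have hopen : IsOpen {v | N (v - v₀) < N v₀ / 2} := isOpen_lt hcont continuous_const
    have hmem : v₀ ∈ {v | N (v - v₀) < N v₀ / 2} := by
      have : N (v₀ - v₀) = 0 := by simp [hN, specRad]
      rw [Set.mem_ofPred_eq, this]
      linarith
    obtain ⟨v, hv, hvd⟩ := hdense.inter_open_nonempty _ hopen ⟨v₀, hmem⟩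
    exact ⟨v, hv, hvd⟩
  have hsymm : N (v₀ - v) = N (v - v₀) := by
    simp only [hN]
    rw [← neg_sub v v₀, map_neg, specRad_neg]
  have hNv : N v₀ / 2 < N v := by linarith [hNsub v₀ v]
  obtain ⟨χ, hχ⟩ := exists_norm_algHom_apply_eq_specRad hCj (L v)
  obtain ⟨ψ, hψ⟩ := exists_norm_algHom_apply_eq_specRad hRj (T (L v))
  have hψle : ∀ c : C, ‖ψ (T c)‖ ≤ specRad c := fun c =>
    (norm_algHom_apply_le_specRad ψ (T c)).trans_eq (hT c)
  have heq : χ.toLinearMap ∘ₗ L = ψ.toLinearMap ∘ₗ T ∘ₗ L :=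
    linearMap_eq_of_differentiableAt hvd (by linarith) (e := Pi.single 0 1)
      (fun w => norm_algHom_apply_le_specRad χ _) hχ (fun w => hψle _) (hψ.trans (hT _))
      (by simp [hL]) (by simp [hL, h1])
  have hi : ∀ i, χ (![1, a, b, a * b, d] i) = ψ (T (![1, a, b, a * b, d] i)) := fun i => by
    have := LinearMap.congr_fun heq (Pi.single i 1)
    simpa [hL] using this
  -- `ψ ∘ T ∘ L` vanishes at `v₀` but has modulus `N v` at the nearby point `v`
  have h0 : ψ (T (L v₀)) = 0 := by
    have ha : χ a = ψ (T a) := hi 1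
    have hb : χ b = ψ (T b) := hi 2
    have hab : χ (a * b) = ψ (T (a * b)) := hi 3
    rw [hLv₀, map_sub, map_sub, ← hab, hd, map_mul, map_mul, ha, hb, sub_self]
  have h2 : N v ≤ N (v - v₀) := by
    have := hψle (L (v - v₀))
    rwa [map_sub, map_sub, map_sub, h0, sub_zero, hψ, hT, ← map_sub] at this
  linarith

end Nagasawa

/-! ### Transported inner automorphisms -/

section Quotient
variable {B : Type*} [NormedRing B] [NormedAlgebra ℂ B]

/-- The quotient norm on the quotient of a normed ring by a closed two-sided ideal. -/
noncomputable abbrev quotientNormedRing (I : Ideal B) [I.IsTwoSided] (hI : IsClosed (I : Set B)) :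
    NormedRing (B ⧸ I) :=
  { @Submodule.Quotient.normedAddCommGroup B _ B _ _ I hI, Ideal.Quotient.ring I with
    norm_mul_le := fun x y => by
      have hmk : ∀ a : B, ‖(Submodule.Quotient.mk a : B ⧸ I)‖ ≤ ‖a‖ :=
        fun a => Submodule.Quotient.norm_mk_le I a
      have hcont : Tendsto (fun ε : ℝ => (‖x‖ + ε) * (‖y‖ + ε)) (𝓝[>] 0) (𝓝 (‖x‖ * ‖y‖)) := by
        have : Continuous fun ε : ℝ => (‖x‖ + ε) * (‖y‖ + ε) := by fun_prop
        simpa using (this.tendsto 0).mono_left nhdsWithin_le_nhds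
      refine ge_of_tendsto hcont (eventually_mem_nhdsWithin.mono fun ε hε => ?_)
      obtain ⟨a, rfl, ha⟩ := Submodule.Quotient.norm_mk_lt (S := I) x hε
      obtain ⟨b, rfl, hb⟩ := Submodule.Quotient.norm_mk_lt (S := I) y hε
      exact (hmk (a * b)).trans ((norm_mul_le a b).trans
        (mul_le_mul ha.le hb.le (norm_nonneg _) ((norm_nonneg a).trans ha.le))) }

/-- The quotient of a normed algebra by a closed two-sided ideal, as a normed algebra. -/
noncomputable abbrev quotientNormedAlgebra (I : Ideal B) [I.IsTwoSided]
    (hI : IsClosed (I : Set B)) : @NormedAlgebra ℂ (B ⧸ I) _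
      (quotientNormedRing I hI).toSeminormedRing :=
  letI := quotientNormedRing I hI
  { Ideal.Quotient.algebra ℂ with
    norm_smul_le := fun c x => 
      (Submodule.Quotient.normedSpace I ℂ).norm_smul_le c x }

end Quotient

section Transport
variable {A B : Type*} [NormedRing A] [NormedAlgebra ℂ A] [CompleteSpace A]
  [NormedRing B] [NormedAlgebra ℂ B]

/-- The inner automorphism of `A` given by `exp x`, transported to `B` along a linear
equivalence. -/
noncomputable def transportConj (e : A ≃ₗ[ℂ] B) (x : A) : B →ₗ[ℂ] B :=
  e.toLinearMap ∘ₗ LinearMap.mulLeft ℂ (expUnit x : A) ∘ₗ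
    LinearMap.mulRight ℂ (↑(expUnit x)⁻¹ : A) ∘ₗ e.symm.toLinearMap

variable (e : A ≃ₗ[ℂ] B)

lemma transportConj_apply (x : A) (b : B) :
    transportConj e x b = e (expUnit x * e.symm b * ↑(expUnit x)⁻¹) := by
  simp [transportConj, mul_assoc]

lemma transportConj_zero (b : B) : transportConj e 0 b = b := by
  simp [transportConj_apply, expUnit_zero]

lemma transportConj_add_self (x : A) (b : B) :
    transportConj e (x + x) b = transportConj e x (transportConj e x b) := by
  simp [transportConj_apply, expUnit_add_self, mul_assoc]

lemma transportConj_one (he : e 1 = 1) (x : A) : transportConj e x 1 = 1 := by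
  have : e.symm 1 = 1 := by rw [← he, e.symm_apply_apply]
  simp [transportConj_apply, this, he]

lemma transportConj_surjective (x : A) : Function.Surjective (transportConj e x) := fun b =>
  ⟨e (↑(expUnit x)⁻¹ * e.symm b * expUnit x), by simp [transportConj_apply, mul_assoc]⟩

lemma specRad_transportConj (hr : ∀ a, specRad (e a) = specRad a) (x : A) (b : B) :
    specRad (transportConj e x b) = specRad b := by
  rw [transportConj_apply, hr, specRad_units_conj, ← hr, e.apply_symm_apply]

lemma differentiable_transportConj (hc : Continuous e) (x : A) (b : B) :
    Differentiable ℂ fun c : ℂ => transportConj e (c • x) b := by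
  let E : A →L[ℂ] B := ⟨e.toLinearMap, hc⟩
  simp only [transportConj_apply]
  exact E.differentiable.comp (differentiable_expUnit_conj x (e.symm b))

variable [CompleteSpace B] {Q : Type*} [NormedRing Q] [NormedAlgebra ℂ Q] [CompleteSpace Q]

omit [CompleteSpace Q] in
lemma specRad_algHom_le (π : B →ₐ[ℂ] Q) (b : B) : specRad (π b) ≤ specRad b :=
  ENNReal.toReal_mono (spectralRadius_ne_top b)
    (iSup_le_iSup_of_subset (AlgHom.spectrum_apply_subset π b))

/-- By Liouville's theorem, a transported inner automorphism does not change the spectral radius in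
a quotient. -/
lemma specRad_quotient_transportConj (hc : Continuous e) (hr : ∀ a, specRad (e a) = specRad a)
    {π : B →ₐ[ℂ] Q} (hπ : Continuous π) (x : A) (b : B) :
    specRad (π (transportConj e x b)) = specRad (π b) := by
  let P : B →L[ℂ] Q := ⟨π.toLinearMap, hπ⟩
  have hd : Differentiable ℂ fun c : ℂ => π (transportConj e (c • x) b) :=
    P.differentiable.comp (differentiable_transportConj e hc x b)
  have := specRad_eq_of_differentiable_of_bounded hd (M := specRad b)
    (fun c => (specRad_algHom_le π _).trans_eq (specRad_transportConj e hr _ b)) 1 0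
  simpa [transportConj_zero] using this

/-- Transported inner automorphisms leave the kernel of a homomorphism onto a semisimple algebra
invariant, and so induce unital surjective spectral isometries of the quotient. -/
theorem exists_isUnitalSurjectiveSpectralIsometry_quotient (hc : Continuous e) (he : e 1 = 1)
    (hr : ∀ a, specRad (e a) = specRad a) (hQ : IsJacobsonSemisimple Q) {π : B →ₐ[ℂ] Q}
    (hπ : Continuous π) (hsurj : Function.Surjective π) (x : A) :
    ∃ S : Q →ₗ[ℂ] Q, IsUnitalSurjectiveSpectralIsometry S ∧
      ∀ b, S (π b) = π (transportConj e x b) := by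
  have hker : LinearMap.ker π.toLinearMap ≤
      LinearMap.ker (π.toLinearMap ∘ₗ transportConj e x) := by
    intro w (hw : π w = 0)
    have hmem : π (transportConj e x w) ∈ Ring.jacobson Q := by
      refine mem_jacobson_of_specRad_add_le fun z => ?_
      obtain ⟨b, rfl⟩ := hsurj z
      obtain ⟨b, rfl⟩ := transportConj_surjective e x b
      rw [← map_add, ← map_add, specRad_quotient_transportConj e hc hr hπ,
        specRad_quotient_transportConj e hc hr hπ, map_add, hw, zero_add]
    rw [hQ] at hmem
    exact hmem
  let S : Q →ₗ[ℂ] Q := ((LinearMap.ker π.toLinearMap).liftQ _ hker).comp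
    (π.toLinearMap.quotKerEquivOfSurjective hsurj).symm.toLinearMap
  have hS : ∀ b, S (π b) = π (transportConj e x b) := by
    intro b
    have h1 : (π.toLinearMap.quotKerEquivOfSurjective hsurj).symm (π b) =
        Submodule.Quotient.mk b := by
      rw [LinearEquiv.symm_apply_eq]
      rfl
    simp only [S, LinearMap.comp_apply, LinearEquiv.coe_coe, h1]
    rfl
  refine ⟨S, ⟨?_, fun q => ?_, fun q => ?_⟩, hS⟩
  · rw [← map_one π, hS, transportConj_one e he]
  · obtain ⟨b, rfl⟩ := hsurj q
    obtain ⟨b, rfl⟩ := transportConj_surjective e x b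
    exact ⟨π b, hS b⟩
  · obtain ⟨b, rfl⟩ := hsurj q
    rw [hS, ← ENNReal.toReal_eq_toReal_iff' (spectralRadius_ne_top _) (spectralRadius_ne_top _)]
    exact specRad_quotient_transportConj e hc hr hπ x b

/-- If the unital surjective spectral isometries of a semisimple quotient are multiplicative or
anti-multiplicative, then the induced maps are squares of such maps, hence multiplicative. -/
theorem quotient_transportConj_mul (hc : Continuous e) (he : e 1 = 1)
    (hr : ∀ a, specRad (e a) = specRad a) (hQ : IsJacobsonSemisimple Q) {π : B →ₐ[ℂ] Q}
    (hπ : Continuous π) (hsurj : Function.Surjective π)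
    (hmul : ∀ S : Q →ₗ[ℂ] Q, IsUnitalSurjectiveSpectralIsometry S →
      IsMultiplicative S ∨ IsAntiMultiplicative S) (x : A) (b c : B) :
    π (transportConj e x (b * c)) = π (transportConj e x b * transportConj e x c) := by
  obtain ⟨S, hSi, hS⟩ := exists_isUnitalSurjectiveSpectralIsometry_quotient e hc he hr hQ hπ hsurj
    ((1 / 2 : ℂ) • x)
  have hx : x = (1 / 2 : ℂ) • x + (1 / 2 : ℂ) • x := by
    rw [← add_smul]; norm_num
  have hSS : ∀ b, π (transportConj e x b) = S (S (π b)) := by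
    intro b
    rw [hS, hS, ← transportConj_add_self, ← hx]
  rw [map_mul π, hSS, hSS, hSS, map_mul π]
  rcases hmul S hSi with h | h
  · rw [h, h]
  · rw [h, h]

/-- The transported inner automorphisms are automorphisms of `B`: the quotients in which they are
multiplicative separate the points. -/
theorem transportConj_mul (hc : Continuous e) (he : e 1 = 1)
    (hr : ∀ a, specRad (e a) = specRad a) {ι : Type*} (I : ι → Ideal B) [∀ i, (I i).IsTwoSided]
    (hclosed : ∀ i, IsClosed (I i : Set B)) (hsep : ⨅ i, I i = ⊥)
    (hss : ∀ i, IsJacobsonSemisimple (B ⧸ I i))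
    (hmul : ∀ i, ∀ S : (B ⧸ I i) →ₗ[ℂ] (B ⧸ I i), IsUnitalSurjectiveSpectralIsometry S →
      IsMultiplicative S ∨ IsAntiMultiplicative S) (x : A) (b c : B) :
    transportConj e x (b * c) = transportConj e x b * transportConj e x c := by
  rw [← sub_eq_zero, ← Submodule.mem_bot B, ← hsep, Submodule.mem_iInf]
  intro i
  let := quotientNormedRing (I i) (hclosed i)
  let := quotientNormedAlgebra (I i) (hclosed i)
  have : CompleteSpace (B ⧸ I i) := Submodule.Quotient.completeSpace (I i)
  have hcont : Continuous (Ideal.Quotient.mkₐ ℂ (I i)) :=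
    (isQuotientMap_quotient_mk' : IsQuotientMap (Submodule.Quotient.mk : B → B ⧸ I i)).continuous
  have := quotient_transportConj_mul e hc he hr (hss i) hcont
    (Ideal.Quotient.mkₐ_surjective ℂ (I i)) (hmul i) x b c
  exact Ideal.Quotient.eq.1 this

end Transport

/-! ### Double commutants and the Jordan product -/

section DoubleCommutant
variable {A B : Type*} [NormedRing A] [NormedAlgebra ℂ A] [CompleteSpace A]
  [NormedRing B] [NormedAlgebra ℂ B] {e : A ≃ₗ[ℂ] B}

lemma expUnit_conj_eq_of_commute {y a : A} (h : Commute y a) (c : ℂ) :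
    (expUnit (c • y) * a * ↑(expUnit (c • y))⁻¹ : A) = a := by
  let := NormedAlgebra.restrictScalars ℚ ℂ A
  have h1 : Commute (expUnit (c • y) : A) a :=
    (SemiconjBy.exp_right (h.smul_left c).symm : SemiconjBy a _ _).symm
  rw [h1.eq, mul_assoc, Units.mul_inv, mul_one]

/-- The elements commuting with `y` form a subalgebra for the transported product too, since they
are fixed by the automorphisms `transportConj e (c • y)`. -/
lemma commute_symm_mul (hmul : ∀ x b c, transportConj e x (b * c) =
      transportConj e x b * transportConj e x c) {y : A} {b c : B} (hb : Commute y (e.symm b))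
    (hc : Commute y (e.symm c)) : Commute y (e.symm (b * c)) := by
  have hfix : ∀ t : ℂ, (expUnit (t • y) * e.symm (b * c) * ↑(expUnit (t • y))⁻¹ : A) =
      e.symm (b * c) := by
    intro t
    have h := hmul (t • y) b c
    simp only [transportConj_apply, expUnit_conj_eq_of_commute hb,
      expUnit_conj_eq_of_commute hc, e.apply_symm_apply] at h
    exact e.injective (h.trans (e.apply_symm_apply _).symm)
  have h := hasDerivAt_expUnit_conj y (e.symm (b * c))
  simp only [hfix] at h
  exact sub_eq_zero.1 (h.unique (hasDerivAt_const 0 _))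

/-- The double commutant of an element. -/
def doubleCommutant (x : A) : Subalgebra ℂ A :=
  Subalgebra.centralizer ℂ (Subalgebra.centralizer ℂ {x} : Set A)

omit [CompleteSpace A] in
lemma mem_doubleCommutant {x a : A} :
    a ∈ doubleCommutant x ↔ ∀ y, Commute y x → Commute y a := by
  simp only [doubleCommutant, Subalgebra.mem_centralizer_iff, SetLike.mem_coe,
    Set.mem_singleton_iff, forall_eq]
  exact ⟨fun h y hy => h y hy.symm.eq, fun h y hy => h y (Eq.symm hy)⟩

omit [CompleteSpace A] in
lemma doubleCommutant_comm {x a b : A} (ha : a ∈ doubleCommutant x) (hb : b ∈ doubleCommutant x) :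
    a * b = b * a :=
  mem_doubleCommutant.1 hb a (mem_doubleCommutant.1 ha x (Commute.refl x)).symm

/-- The image of a double commutant under `e`, as a subalgebra of `B`. It is encoded as the preimage
under `e.symm`; it is closed under products by `commute_symm_mul`. -/
def doubleCommutantImage (he : e 1 = 1) (hmul : ∀ x b c, transportConj e x (b * c) =
      transportConj e x b * transportConj e x c) (x : A) : Subalgebra ℂ B where
  carrier := {b | e.symm b ∈ doubleCommutant x}
  mul_mem' := fun {b c} hb hc => mem_doubleCommutant.2 fun y hy =>
    commute_symm_mul hmul (mem_doubleCommutant.1 hb y hy) (mem_doubleCommutant.1 hc y hy)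
  add_mem' := fun {b c} hb hc => by
    rw [Set.mem_ofPred_eq, map_add]
    exact add_mem hb hc
  algebraMap_mem' := fun c => by
    have : e.symm 1 = 1 := by rw [← he, e.symm_apply_apply]
    rw [Set.mem_ofPred_eq, Algebra.algebraMap_eq_smul_one, map_smul, this]
    exact Subalgebra.smul_mem _ (one_mem _) c

variable [CompleteSpace B]

/-- Nagasawa's theorem on the double commutant `C` of `x`: the map `e` is multiplicative on `C` up
to quasinilpotent elements, so that no character of `e C` vanishes at `e a` when `a` is invertible
in `C`. -/
theorem doubleCommutant_map_mul (hcont : Continuous e) (he : e 1 = 1)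
    (hr : ∀ a, specRad (e a) = specRad a) (hmul : ∀ x b c, transportConj e x (b * c) =
      transportConj e x b * transportConj e x c) {x : A} :
    (∀ a ∈ doubleCommutant x, ∀ b ∈ doubleCommutant x, e.symm (e a * e b) ∈ doubleCommutant x ∧
      specRad (e (a * b) - e a * e b) = 0) ∧
    ∀ a ∈ doubleCommutant x, ∀ b ∈ doubleCommutant x, a * b = 1 → IsUnit (e a) := by
  set C := doubleCommutant x
  set R := doubleCommutantImage he hmul x
  have hcont' : Continuous e.symm := (e.toContinuousLinearEquivOfContinuous hcont).symm.continuous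
  have hCcl : IsClosed (C : Set A) := Set.isClosed_centralizer _
  have : CompleteSpace C := hCcl.completeSpace_coe
  have : CompleteSpace R := (hCcl.preimage hcont').completeSpace_coe
  have hmem : ∀ c : C, e c ∈ R := fun c => by
    change e.symm (e c) ∈ C
    rw [e.symm_apply_apply]
    exact c.2
  let T : C →ₗ[ℂ] R := (e.toLinearMap ∘ₗ C.val.toLinearMap).codRestrict
    (Subalgebra.toSubmodule R) hmem
  have hTc : ∀ c : C, (T c : B) = e c := fun c => rfl
  have hT1 : T 1 = 1 := Subtype.ext he
  have hTs : Function.Surjective T := fun r => ⟨⟨e.symm r, r.2⟩, Subtype.ext (e.apply_symm_apply _)⟩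
  have hTr : ∀ c, specRad (T c) = specRad c := fun c => by
    rw [specRad_subalgebra, specRad_subalgebra, hTc, hr]
  have hC : ∀ a b : C, a * b = b * a := fun a b => Subtype.ext (doubleCommutant_comm a.2 b.2)
  have hnag := specRad_map_mul_sub_eq_zero hC hT1 hTs hTr
  refine ⟨fun a ha b hb => ⟨?_, ?_⟩, fun a ha b hb hab => ?_⟩
  · exact R.mul_mem (hmem ⟨a, ha⟩) (hmem ⟨b, hb⟩)
  · have := hnag ⟨a, ha⟩ ⟨b, hb⟩
    rwa [specRad_subalgebra] at this
  · suffices IsUnit (T ⟨a, ha⟩) from this.map R.val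
    by_contra hu
    obtain ⟨ψ, hψ⟩ := exists_algHom_apply_eq_zero
      (commutator_mem_jacobson_of_specRad_eq hC hTs hTr) hu
    have h := norm_algHom_apply_le_specRad ψ
      (T (⟨a, ha⟩ * ⟨b, hb⟩) - T ⟨a, ha⟩ * T ⟨b, hb⟩)
    have hone : (⟨a, ha⟩ * ⟨b, hb⟩ : C) = 1 := Subtype.ext hab
    rw [hnag, hone, hT1, map_sub, map_mul, hψ, zero_mul, map_one, sub_zero, norm_one] at h
    exact absurd h (by norm_num)

/-- The double commutant of an invertible element contains its inverse, so `e` preserves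
invertibility. -/
theorem isUnit_map_of_transportConj_mul (hcont : Continuous e) (he : e 1 = 1)
    (hr : ∀ a, specRad (e a) = specRad a) (hmul : ∀ x b c, transportConj e x (b * c) =
      transportConj e x b * transportConj e x c) {x : A} (hx : IsUnit x) : IsUnit (e x) := by
  obtain ⟨u, rfl⟩ := hx
  refine (doubleCommutant_map_mul hcont he hr hmul (x := (u : A))).2 u ?_ (↑u⁻¹ : A) ?_ u.mul_inv
  · exact mem_doubleCommutant.2 fun y hy => hy
  · exact mem_doubleCommutant.2 fun y hy => hy.units_inv_right

/-- In a C⋆-algebra, the double commutant of a self-adjoint element consists of normal elements, so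
it contains no quasinilpotent element except `0`. -/
theorem map_mul_self_of_isSelfAdjoint [StarRing A] [StarModule ℂ A] [CStarRing A]
    (hcont : Continuous e) (he : e 1 = 1)
    (hr : ∀ a, specRad (e a) = specRad a) (hmul : ∀ x b c, transportConj e x (b * c) =
      transportConj e x b * transportConj e x c) {x : A} (hx : IsSelfAdjoint x) :
    e (x * x) = e x * e x := by
  let _ : CStarAlgebra A := { ‹NormedRing A›, ‹StarRing A›, ‹CompleteSpace A›, ‹CStarRing A›,
    ‹NormedAlgebra ℂ A›, ‹StarModule ℂ A› with }
  have hxC : x ∈ doubleCommutant x := mem_doubleCommutant.2 fun y hy => hy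
  obtain ⟨h1, h2⟩ := (doubleCommutant_map_mul hcont he hr hmul).1 x hxC x hxC
  set w := x * x - e.symm (e x * e x) with hw
  have hwC : w ∈ doubleCommutant x := sub_mem (mul_mem hxC hxC) h1
  have hew : e w = e (x * x) - e x * e x := by rw [hw, map_sub, e.apply_symm_apply]
  have hwC' : star w ∈ doubleCommutant x := by
    refine mem_doubleCommutant.2 fun y hy => ?_
    have hy' : Commute (star y) x := by
      have := hy.star_star
      rwa [hx.star_eq] at this
    simpa using (mem_doubleCommutant.1 hwC _ hy').star_star
  have hnormal : IsStarNormal w := ⟨doubleCommutant_comm hwC' hwC⟩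
  have hw0 : ‖w‖ = 0 := by
    have h3 : specRad w = ‖w‖ := by
      rw [specRad, IsStarNormal.spectralRadius_eq_nnnorm]
      simp
    rw [← h3, ← hr, hew, h2]
  rw [norm_eq_zero] at hw0
  rw [hw0, map_zero] at hew
  exact sub_eq_zero.1 hew.symm

end DoubleCommutant

section Jordan
variable {A B : Type*} [Ring A] [StarRing A] [Algebra ℂ A] [StarModule ℂ A] [Ring B] [Algebra ℂ B]

/-- Polarization: a linear map which preserves squares of self-adjoint elements preserves the
Jordan product. -/
theorem map_jordan_of_map_mul_self {T : A →ₗ[ℂ] B}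
    (hT : ∀ x : A, IsSelfAdjoint x → T (x * x) = T x * T x) (a b : A) :
    T (a * b + b * a) = T a * T b + T b * T a := by
  have hsa : ∀ h k : A, IsSelfAdjoint h → IsSelfAdjoint k →
      T (h * k) + T (k * h) = T h * T k + T k * T h := by
    intro h k hh hk
    have h1 := hT (h + k) (hh.add hk)
    simp only [add_mul, mul_add, map_add, hT h hh, hT k hk] at h1
    have h2 : T (h * k) + T (k * h) + (T h * T h + T k * T k) =
        T h * T k + T k * T h + (T h * T h + T k * T k) := by
      rw [← sub_eq_zero] at h1 ⊢
      rw [← h1]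
      abel
    exact add_right_cancel h2
  have hleft : ∀ h : A, IsSelfAdjoint h → ∀ b, T (h * b) + T (b * h) = T h * T b + T b * T h := by
    intro h hh b
    have h1 := hsa h _ hh (realPart b).2
    have h2 := hsa h _ hh (imaginaryPart b).2
    rw [← realPart_add_I_smul_imaginaryPart b]
    simp only [mul_add, add_mul, map_add, mul_smul_comm, smul_mul_assoc, map_smul]
    linear_combination (norm := module) h1 + Complex.I • h2
  have h1 := hleft _ (realPart a).2 b
  have h2 := hleft _ (imaginaryPart a).2 b
  rw [map_add, ← realPart_add_I_smul_imaginaryPart a]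
  simp only [mul_add, add_mul, map_add, mul_smul_comm, smul_mul_assoc, map_smul]
  linear_combination (norm := module) h1 + Complex.I • h2

end Jordan

theorem proposition3p3
    {A B : Type*}
    [NormedRing A] [NormedAlgebra ℂ A] [CompleteSpace A]
    [NormedRing B] [NormedAlgebra ℂ B] [CompleteSpace B]
    (hA : IsJacobsonSemisimple A) (hB : IsJacobsonSemisimple B)
    (T : A →ₗ[ℂ] B) (hT : IsUnitalSurjectiveSpectralIsometry T)
    {ι : Type*} (I : ι → Ideal B) [∀ i, (I i).IsTwoSided]
    (hclosed : ∀ i, IsClosed (I i : Set B))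
    (hsep : ⨅ i, I i = ⊥)
    (hss : ∀ i, IsJacobsonSemisimple (B ⧸ I i))
    (hmul : ∀ i, ∀ S : (B ⧸ I i) →ₗ[ℂ] (B ⧸ I i), IsUnitalSurjectiveSpectralIsometry S →
      IsMultiplicative S ∨ IsAntiMultiplicative S) :
    PreservesInvertibility T ∧
      (∀ [StarRing A] [StarModule ℂ A] [CStarRing A], IsJordanIsomorphism T) := by
  have hr : ∀ a, specRad (T a) = specRad a := fun a => by
    rw [specRad, specRad, hT.isSpectralIsometry a]
  let e : A ≃ₗ[ℂ] B :=
    LinearEquiv.ofBijective T ⟨injective_of_specRad_eq hA hr, hT.surjective⟩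
  have hcont : Continuous e := continuous_of_specRad_eq hB hr hT.surjective
  have hmul' := transportConj_mul e hcont hT.map_one hr I hclosed hsep hss hmul
  refine ⟨fun a ha => isUnit_map_of_transportConj_mul (e := e) hcont hT.map_one hr hmul' ha, ?_⟩
  intro _ _ _
  exact ⟨e.bijective, map_jordan_of_map_mul_self fun x hx =>
    map_mul_self_of_isSelfAdjoint (e := e) hcont hT.map_one hr hmul' hx⟩
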